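/- Let $H$ be a separable real Hilbert space and $\mathbb{R}_>=(0,\infty)$. For $I\in\{\mathbb{R},\mathbb{R}_>\}$ let $H^1(I;H)$ be the space of $u\in L^2(I;H)$ whose distributional derivative lies in $L^2(I;H)$, let $H^1_{0,\{0\}}(\mathbb{R}_>;H)=\{v\in H^1(\mathbb{R}_>;H): v(0)=0\}$ (where $v(0)$ is the value at $0$ of the continuous representative of $v$ on $[0,\infty)$), and define by Hilbert space interpolation $$H^{1/2}(I;H)=[L^2(I;H),H^1(I;H)]_{1/2},\qquad H^{1/2}_{00,\{0\}}(\mathbb{R}_>;H)=[L^2(\mathbb{R}_>;H),H^1_{0,\{0\}}(\mathbb{R}_>;H)]_{1/2}.$$ Put $$\|u\|^2_{H^{1/2}(I;H)}=\|u\|^2_{L^2(I;H)}+\int_I\int_I\frac{\|u(s)-u(t)\|_H^2}{|s-t|^2}\,ds\,dt,$$ $$\|w\|^2_{H^{1/2}_{00,\{0\}}(\mathbb{R}_>;H)}=\|w\|^2_{H^{1/2}(\mathbb{R}_>;H)}+\int_0^\infty\frac{\|w(s)\|_H^2}{s}\,ds,$$ and let $E_0w$ denote the extension of $w$ by zero from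 $\mathbb{R}_>$ to $\mathbb{R}$. Then $$H^{1/2}_{00,\{0\}}(\mathbb{R}_>;H)=\{w\in H^{1/2}(\mathbb{R}_>;H): E_0w\in H^{1/2}(\mathbb{R};H)\}.$$ Moreover $w\mapsto\|E_0w\|_{H^{1/2}(\mathbb{R};H)}$ is a (finite) norm on $H^{1/2}_{00,\{0\}}(\mathbb{R}_>;H)$, and it is equivalent to $\|\cdot\|_{H^{1/2}_{00,\{0\}}(\mathbb{R}_>;H)}$: for every $w\in H^{1/2}_{00,\{0\}}(\mathbb{R}_>;H)$, $$\|w\|^2_{H^{1/2}_{00,\{0\}}(\mathbb{R}_>;H)}\le\|E_0w\|^2_{H^{1/2}(\mathbb{R};H)}\le 2\,\|w\|^2_{H^{1/2}_{00,\{0\}}(\mathbb{R}_>;H)}<\infty.$$ -/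

import Mathlib

open MeasureTheory Set
open scoped ENNReal ContDiff

noncomputable section

namespace ZeroExt

/-! ### Interpolation between two Hilbert spaces -/

section Interpolation

variable {X Y : Type*} [NormedAddCommGroup X] [NormedSpace ℝ X]
  [NormedAddCommGroup Y] [NormedSpace ℝ Y]

/-- The square of Peetre's K-functional of a pair `ι : X → Y` (an embedding), in its quadratic
form: `K(t, u)² = inf { ‖u₀‖_Y² + t² ‖u₁‖_X² : u = u₀ + u₁, u₀ ∈ Y, u₁ ∈ X }`. -/
def kFunctionalSq (ι : X →ₗ[ℝ] Y) (t : ℝ) (u : Y) : ℝ≥0∞ :=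
  ⨅ x : X, (‖u - ι x‖ₑ ^ 2 + ENNReal.ofReal (t ^ 2) * ‖x‖ₑ ^ 2)

/-- The square of the interpolation norm, `∫_0^∞ (t^{-s} K(t, u))² dt / t`. -/
def interpNormSq (ι : X →ₗ[ℝ] Y) (s : ℝ) (u : Y) : ℝ≥0∞ :=
  ∫⁻ t in Ioi (0 : ℝ), ENNReal.ofReal (t ^ (-(2 * s) - 1)) * kFunctionalSq ι t u

theorem kFunctionalSq_mono (ι : X →ₗ[ℝ] Y) (u : Y) {a b : ℝ} (ha : 0 ≤ a) (hab : a ≤ b) :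
    kFunctionalSq ι a u ≤ kFunctionalSq ι b u := by
  unfold kFunctionalSq
  gcongr

theorem aemeasurable_kFunctionalSq (ι : X →ₗ[ℝ] Y) (u : Y) :
    AEMeasurable (fun t => kFunctionalSq ι t u) (volume.restrict (Ioi (0 : ℝ))) :=
  aemeasurable_restrict_of_monotoneOn measurableSet_Ioi
    (fun _ ha _ _ hab => kFunctionalSq_mono ι u (le_of_lt ha) hab)

theorem kFunctionalSq_zero (ι : X →ₗ[ℝ] Y) (t : ℝ) : kFunctionalSq ι t (0 : Y) = 0 := by
  refine le_antisymm ((iInf_le _ (0 : X)).trans ?_) (zero_le)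
  simp

theorem enorm_add_sq_le {Z : Type*} [NormedAddCommGroup Z] (a b : Z) :
    ‖a + b‖ₑ ^ 2 ≤ 2 * (‖a‖ₑ ^ 2 + ‖b‖ₑ ^ 2) := by
  have h : ‖a + b‖ ^ 2 ≤ 2 * (‖a‖ ^ 2 + ‖b‖ ^ 2) := by
    nlinarith [norm_add_le a b, norm_nonneg (a + b), sq_nonneg (‖a‖ - ‖b‖)]
  have h' := ENNReal.ofReal_le_ofReal h
  rwa [ENNReal.ofReal_mul (by norm_num), ENNReal.ofReal_add (by positivity) (by positivity),
    ENNReal.ofReal_pow (norm_nonneg _), ENNReal.ofReal_pow (norm_nonneg _),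
    ENNReal.ofReal_pow (norm_nonneg _), ofReal_norm, ofReal_norm, ofReal_norm,
    ENNReal.ofReal_ofNat] at h'

theorem kFunctionalSq_add_le (ι : X →ₗ[ℝ] Y) (t : ℝ) (u v : Y) :
    kFunctionalSq ι t (u + v) ≤ 2 * (kFunctionalSq ι t u + kFunctionalSq ι t v) := by
  unfold kFunctionalSq
  rw [ENNReal.iInf_add, ENNReal.mul_iInf_of_ne (by norm_num) (by norm_num)]
  refine le_iInf fun x => ?_
  rw [ENNReal.add_iInf, ENNReal.mul_iInf_of_ne (by norm_num) (by norm_num)]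
  refine le_iInf fun y => (iInf_le _ (x + y)).trans ?_
  have e : u + v - ι (x + y) = (u - ι x) + (v - ι y) := by rw [map_add]; abel
  rw [e]
  calc _ ≤ 2 * (‖u - ι x‖ₑ ^ 2 + ‖v - ι y‖ₑ ^ 2)
        + ENNReal.ofReal (t ^ 2) * (2 * (‖x‖ₑ ^ 2 + ‖y‖ₑ ^ 2)) := by
        gcongr
        · exact enorm_add_sq_le _ _
        · exact enorm_add_sq_le _ _
    _ = _ := by ring

theorem kFunctionalSq_smul_le (ι : X →ₗ[ℝ] Y) (t c : ℝ) (u : Y) :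
    kFunctionalSq ι t (c • u) ≤ ‖c‖ₑ ^ 2 * kFunctionalSq ι t u := by
  by_cases hc : c = 0
  · simp [hc, kFunctionalSq_zero]
  have h0 : ‖c‖ₑ ^ 2 ≠ 0 := by simpa using hc
  unfold kFunctionalSq
  rw [ENNReal.mul_iInf_of_ne h0 (by simp)]
  refine le_iInf fun x => (iInf_le _ (c • x)).trans (le_of_eq ?_)
  rw [map_smul, ← smul_sub, enorm_smul, enorm_smul]
  ring

/-- The Hilbert interpolation space `[Y, X]_s` (`0 < s < 1`) between two Hilbert spaces with dense
embedding `ι : X → Y`, as a subspace of `Y`: the vectors of finite interpolation norm. If `Λ` is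
the positive self-adjoint operator in `Y` with domain `X` and `‖Λ x‖_Y = ‖x‖_X`, then
`K(t, u)² = ⟪t² Λ² (1 + t² Λ²)⁻¹ u, u⟫`, so that the interpolation norm is a constant multiple of
`‖Λ^s u‖_Y` and the space is the domain of `Λ^s`. -/
def interpSpace (ι : X →ₗ[ℝ] Y) (s : ℝ) : Submodule ℝ Y where
  carrier := {u | interpNormSq ι s u < ⊤}
  zero_mem' := by
    simp [interpNormSq, kFunctionalSq_zero]
  add_mem' := by
    intro u v hu hv
    simp only [mem_ofPred_eq] at hu hv ⊢
    have hm : AEMeasurable (fun t : ℝ => ENNReal.ofReal (t ^ (-(2 * s) - 1)) *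
        kFunctionalSq ι t u) (volume.restrict (Ioi (0 : ℝ))) :=
      (Measurable.aemeasurable (by fun_prop)).mul (aemeasurable_kFunctionalSq ι u)
    calc interpNormSq ι s (u + v)
        ≤ ∫⁻ t in Ioi (0 : ℝ), 2 * (ENNReal.ofReal (t ^ (-(2 * s) - 1)) * kFunctionalSq ι t u
          + ENNReal.ofReal (t ^ (-(2 * s) - 1)) * kFunctionalSq ι t v) := by
          refine lintegral_mono fun t => ?_
          calc _ ≤ ENNReal.ofReal (t ^ (-(2 * s) - 1)) *
                (2 * (kFunctionalSq ι t u + kFunctionalSq ι t v)) := by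
                gcongr; exact kFunctionalSq_add_le ι t u v
            _ = _ := by ring
      _ = 2 * (interpNormSq ι s u + interpNormSq ι s v) := by
          rw [lintegral_const_mul' _ _ (by norm_num), lintegral_add_left' hm]
          rfl
      _ < ⊤ := ENNReal.mul_lt_top (by norm_num) (ENNReal.add_lt_top.2 ⟨hu, hv⟩)
  smul_mem' := by
    intro c u hu
    simp only [mem_ofPred_eq] at hu ⊢
    calc interpNormSq ι s (c • u)
        ≤ ∫⁻ t in Ioi (0 : ℝ), ‖c‖ₑ ^ 2 *
          (ENNReal.ofReal (t ^ (-(2 * s) - 1)) * kFunctionalSq ι t u) := by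
          refine lintegral_mono fun t => ?_
          calc _ ≤ ENNReal.ofReal (t ^ (-(2 * s) - 1)) * (‖c‖ₑ ^ 2 * kFunctionalSq ι t u) := by
                gcongr; exact kFunctionalSq_smul_le ι t c u
            _ = _ := by ring
      _ = ‖c‖ₑ ^ 2 * interpNormSq ι s u := by
          rw [lintegral_const_mul' _ _ (by simp)]
          rfl
      _ < ⊤ := ENNReal.mul_lt_top (by simp [lt_top_iff_ne_top]) hu

end Interpolation

/-! ### Bochner and Bochner-Sobolev spaces on a subset `I` of the line -/

section Spaces

variable (I : Set ℝ) (H : Type*) [NormedAddCommGroup H] [InnerProductSpace ℝ H]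

/-- The Bochner space `L²(I; H)`. -/
abbrev L2 : Type _ := Lp H 2 (volume.restrict I)

variable {H}

/-- `v` is the distributional derivative of `u` on `I`:
`∫_I φ' u = - ∫_I φ v` for all test functions `φ ∈ C_c^∞(I)`. -/
def HasWeakDeriv (u v : L2 I H) : Prop :=
  ∀ φ : ℝ → ℝ, ContDiff ℝ ∞ φ → HasCompactSupport φ → tsupport φ ⊆ I →
    ∫ t in I, deriv φ t • u t = - ∫ t in I, φ t • v t

variable {I}

theorem integrable_smul_L2 {ψ : ℝ → ℝ} (hψ : Continuous ψ) (hc : HasCompactSupport ψ)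
    (u : L2 I H) : Integrable (fun t => ψ t • u t) (volume.restrict I) :=
  memLp_one_iff_integrable.1
    ((Lp.memLp u).smul ((hψ.memLp_of_hasCompactSupport (p := 2) hc).restrict I))

theorem integral_smul_add {ψ : ℝ → ℝ} (hψ : Continuous ψ) (hc : HasCompactSupport ψ)
    (u v : L2 I H) :
    ∫ t in I, ψ t • (u + v : L2 I H) t = (∫ t in I, ψ t • u t) + ∫ t in I, ψ t • v t := by
  rw [← integral_add (integrable_smul_L2 hψ hc u) (integrable_smul_L2 hψ hc v)]
  refine integral_congr_ae ?_
  filter_upwards [Lp.coeFn_add u v] with t ht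
  rw [ht, Pi.add_apply, smul_add]

theorem integral_smul_smul (ψ : ℝ → ℝ) (c : ℝ) (u : L2 I H) :
    ∫ t in I, ψ t • (c • u : L2 I H) t = c • ∫ t in I, ψ t • u t := by
  rw [← integral_smul]
  refine integral_congr_ae ?_
  filter_upwards [Lp.coeFn_smul c u] with t ht
  rw [ht, Pi.smul_apply, smul_comm]

theorem integral_smul_zero (ψ : ℝ → ℝ) : ∫ t in I, ψ t • (0 : L2 I H) t = 0 := by
  refine integral_eq_zero_of_ae ?_
  filter_upwards [Lp.coeFn_zero H 2 (volume.restrict I)] with t ht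
  rw [ht, Pi.zero_apply, smul_zero]

variable (I H)

/-- The Sobolev space `H¹(I; H)`, realized as the space of pairs `(u, u')` in
`L²(I; H) × L²(I; H)`; its norm is `(‖u‖² + ‖u'‖²)^{1/2}`. -/
def H1 : Submodule ℝ (WithLp 2 (L2 I H × L2 I H)) where
  carrier := {p | HasWeakDeriv I p.fst p.snd}
  zero_mem' := by
    intro φ _ _ _
    rw [WithLp.zero_fst, WithLp.zero_snd, integral_smul_zero, integral_smul_zero, neg_zero]
  add_mem' := by
    intro p q hp hq φ hφ hc hs
    rw [WithLp.add_fst, WithLp.add_snd,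
      integral_smul_add (hφ.continuous_deriv (by simp)) hc.deriv,
      integral_smul_add hφ.continuous hc, hp φ hφ hc hs, hq φ hφ hc hs]
    abel
  smul_mem' := by
    intro c p hp φ hφ hc hs
    rw [WithLp.smul_fst, WithLp.smul_snd, integral_smul_smul, integral_smul_smul,
      hp φ hφ hc hs, smul_neg]

/-- The space `H¹_{0,{0}}(ℝ_>; H) = {v ∈ H¹(ℝ_>; H) : v(0) = 0}`, where `v(0)` is the value at `0`
of the representative of `v` that is continuous on `[0, ∞)`. -/
def H10 : Submodule ℝ (WithLp 2 (L2 (Ioi 0) H × L2 (Ioi 0) H)) where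
  carrier := {p | p ∈ H1 (Ioi 0) H ∧ ∃ g : ℝ → H, ContinuousOn g (Ici 0) ∧ g 0 = 0 ∧
    p.fst =ᵐ[volume.restrict (Ioi 0)] g}
  zero_mem' := by
    refine ⟨zero_mem _, 0, continuousOn_const, rfl, ?_⟩
    rw [WithLp.zero_fst]
    exact Lp.coeFn_zero _ _ _
  add_mem' := by
    rintro p q ⟨hp, g, hg, hg0, hgp⟩ ⟨hq, k, hk, hk0, hkq⟩
    refine ⟨add_mem hp hq, g + k, hg.add hk, by simp [hg0, hk0], ?_⟩
    rw [WithLp.add_fst]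
    exact (Lp.coeFn_add _ _).trans (hgp.add hkq)
  smul_mem' := by
    rintro c p ⟨hp, g, hg, hg0, hgp⟩
    refine ⟨Submodule.smul_mem _ c hp, c • g, hg.const_smul c, by simp [hg0], ?_⟩
    rw [WithLp.smul_fst]
    exact (Lp.coeFn_smul _ _).trans (hgp.const_smul c)

/-- The embedding `H¹(I; H) → L²(I; H)`, `(u, u') ↦ u`. -/
def H1.embed : H1 I H →ₗ[ℝ] L2 I H :=
  (WithLp.fstₗ 2 ℝ (L2 I H) (L2 I H)).comp (H1 I H).subtype

/-- The embedding `H¹_{0,{0}}(ℝ_>; H) → L²(ℝ_>; H)`, `(u, u') ↦ u`. -/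
def H10.embed : H10 H →ₗ[ℝ] L2 (Ioi 0) H :=
  (WithLp.fstₗ 2 ℝ (L2 (Ioi 0) H) (L2 (Ioi 0) H)).comp (H10 H).subtype

/-- `H^{1/2}(I; H) = [L²(I; H), H¹(I; H)]_{1/2}`. -/
def HHalf : Submodule ℝ (L2 I H) := interpSpace (H1.embed I H) (1 / 2)

/-- `H^{1/2}_{00,{0}}(ℝ_>; H) = [L²(ℝ_>; H), H¹_{0,{0}}(ℝ_>; H)]_{1/2}`. -/
def HHalf00 : Submodule ℝ (L2 (Ioi 0) H) := interpSpace (H10.embed H) (1 / 2)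

variable {I H}

/-- The square of the intrinsic norm of `H^{1/2}(I; H)`,
`‖u‖²_{L²(I;H)} + ∫_I ∫_I ‖u(s) - u(t)‖² / |s - t|² ds dt`. -/
def hHalfNormSq (u : L2 I H) : ℝ≥0∞ :=
  ‖u‖ₑ ^ 2 + ∫⁻ t in I, ∫⁻ s in I, ‖u s - u t‖ₑ ^ 2 / ENNReal.ofReal (|s - t| ^ 2)

/-- The square of the intrinsic norm of `H^{1/2}_{00,{0}}(ℝ_>; H)`, which has the additional term
`∫_0^∞ ‖u(s)‖² / s ds`. -/
def hHalf00NormSq (u : L2 (Ioi 0) H) : ℝ≥0∞ :=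
  hHalfNormSq u + ∫⁻ s in Ioi (0 : ℝ), ‖u s‖ₑ ^ 2 / ENNReal.ofReal s

/-- The extension by zero `E₀ : L²(ℝ_>; H) → L²(ℝ; H)`. -/
def zeroExt (w : L2 (Ioi 0) H) : L2 univ H :=
  MemLp.toLp ((Ioi (0 : ℝ)).indicator w) (by
    rw [Measure.restrict_univ, memLp_indicator_iff_restrict measurableSet_Ioi]
    exact Lp.memLp w)

end Spaces

end ZeroExt

end

/-! The set identity is a retraction argument in interpolation theory. Extension by zero E₀ is
isometric on L² and carries H¹_{0,{0}}(ℝ_>) into H¹(ℝ), because the zero boundary value leaves no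
jump at 0; interpolating, E₀ maps H^{1/2}_{00} into H^{1/2}(ℝ) (`zeroExt_mem_HHalf`). Conversely, u
↦ u(t) - u(-t) is bounded on L², and from H¹(ℝ) to H¹_{0,{0}}(ℝ_>) since the difference vanishes at
0. It is a left inverse of E₀, so interpolating it recovers w from E₀w (`mem_HHalf00_of_zeroExt`).

The norm estimates rest on an exact formula, `hHalfNormSq_zeroExt`: ‖E₀w‖² equals the intrinsic norm
squared of w plus twice ∫ ‖w(s)‖²/s ds, one copy from each mixed quadrant of the plane. The
constants 1 and 2 are read off from it.

Finiteness needs a link between interpolation and the double integral: the L² modulus of continuity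
at step h is bounded by the K-functional at h, and the weight h⁻² is exactly the interpolation
weight for s = 1/2 (`hHalfNormSq_lt_top`). -/

noncomputable section

namespace ZeroExt

/-! ### Weak derivatives on the line and half-line: increments, continuity, extension by zero. -/

section WeakDerivative

variable {H : Type*} [NormedAddCommGroup H] [InnerProductSpace ℝ H]

/-- `V` is the distributional derivative on `I` of `U`, for functions given on the whole line. -/
def WeakDerivOn (I : Set ℝ) (U V : ℝ → H) : Prop :=
  ∀ φ : ℝ → ℝ, ContDiff ℝ ∞ φ → HasCompactSupport φ → tsupport φ ⊆ I →
    ∫ t, deriv φ t • U t = -∫ t, φ t • V t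

/-- For shifts in (0, h] only values of V on the compact set supp φ + [0, h] matter, so the product
is a bounded function times an integrable one. This justifies Fubini in
`integral_smul_integral_translate`. -/
theorem integrable_smul_translate {V : ℝ → H} (hV : LocallyIntegrable V) {φ : ℝ → ℝ}
    (hφ : Continuous φ) (hc : HasCompactSupport φ) (h : ℝ) :
    Integrable (fun z : ℝ × ℝ => φ (z.2 - z.1) • V z.2)
      ((volume.restrict (Ioc 0 h)).prod volume) := by
  set K := (fun z : ℝ × ℝ => z.1 + z.2) '' (tsupport φ ×ˢ Icc 0 h) with hK
  have hKc : IsCompact K := (hc.prod isCompact_Icc).image (by fun_prop)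
  have hi : Integrable (K.indicator V) :=
    (integrable_indicator_iff hKc.measurableSet).2 (hV.integrableOn_isCompact hKc)
  obtain ⟨C, hC⟩ := hφ.bounded_above_of_compact_support hc
  have := (hi.comp_snd (volume.restrict (Ioc 0 h))).bdd_smul
    (φ := fun z : ℝ × ℝ => φ (z.2 - z.1)) C
    (Continuous.aestronglyMeasurable (by fun_prop)) (.of_forall fun z => hC _)
  refine this.congr ?_
  have hm : ∀ᵐ z : ℝ × ℝ ∂((volume.restrict (Ioc 0 h)).prod volume), z.1 ∈ Ioc 0 h :=
    Measure.quasiMeasurePreserving_fst.ae (ae_restrict_mem measurableSet_Ioc)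
  filter_upwards [hm] with z hz
  simp only [Pi.smul_apply']
  by_cases h0 : φ (z.2 - z.1) = 0
  · simp [h0]
  · rw [indicator_of_mem]
    exact ⟨(z.2 - z.1, z.1), ⟨subset_tsupport _ h0, hz.1.le, hz.2⟩, by simp⟩

/-- Fubini and translation invariance: integration over a forward window is adjoint to integration
over a backward window, so the window can be moved onto the test function. -/
theorem integral_smul_integral_translate [CompleteSpace H] {V : ℝ → H}
    (hV : LocallyIntegrable V) {φ : ℝ → ℝ}
    (hφ : Continuous φ) (hc : HasCompactSupport φ) {h : ℝ} (hh : 0 ≤ h) :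
    ∫ t, φ t • (∫ r in t..t + h, V r) = ∫ t, (∫ r in (t - h)..t, φ r) • V t := by
  have hi := integrable_smul_translate hV hφ hc h
  have hj : Integrable (fun z : ℝ × ℝ => φ z.2 • V (z.1 + z.2))
      ((volume.restrict (Ioc 0 h)).prod volume) := by
    have := ((measurePreserving_prod_add (volume.restrict (Ioc 0 h)) (volume : Measure ℝ)
      ).integrable_comp hi.aestronglyMeasurable).2 hi
    simpa [Function.comp_def] using this
  calc ∫ t, φ t • (∫ r in t..t + h, V r)
      = ∫ t, ∫ r in Ioc 0 h, φ t • V (r + t) := by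
        refine integral_congr_ae (.of_forall fun t => ?_)
        simp only
        rw [integral_smul, ← intervalIntegral.integral_of_le hh,
          intervalIntegral.integral_comp_add_right (fun x => V x), zero_add, add_comm h t]
    _ = ∫ r in Ioc 0 h, ∫ t, φ t • V (r + t) := (integral_integral_swap hj).symm
    _ = ∫ r in Ioc 0 h, ∫ t, φ (t - r) • V t := by
        refine integral_congr_ae (.of_forall fun r => ?_)
        simp only
        rw [← integral_add_left_eq_self (fun t => φ (t - r) • V t) r]
        simp
    _ = ∫ t, ∫ r in Ioc 0 h, φ (t - r) • V t := integral_integral_swap hi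
    _ = ∫ t, (∫ r in (t - h)..t, φ r) • V t := by
        refine integral_congr_ae (.of_forall fun t => ?_)
        simp only
        rw [integral_smul_const, ← intervalIntegral.integral_of_le hh,
          intervalIntegral.integral_comp_sub_left (fun x => φ x), sub_zero]

/-- The moving window integral `t ↦ ∫_{t-h}^t φ` is a primitive of `φ - φ (· - h)`. -/
theorem hasDerivAt_integral_window {φ : ℝ → ℝ} (hφ : Continuous φ) (h t : ℝ) :
    HasDerivAt (fun t => ∫ r in (t - h)..t, φ r) (φ t - φ (t - h)) t := by
  have e : (fun t => ∫ r in (t - h)..t, φ r)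
      = fun t => (∫ r in (0 : ℝ)..t, φ r) - ∫ r in (0 : ℝ)..(t - h), φ r := by
    ext t
    rw [intervalIntegral.integral_interval_sub_left] <;> exact hφ.intervalIntegrable _ _
  rw [e]
  have d : ∀ x, HasDerivAt (fun t => ∫ r in (0 : ℝ)..t, φ r) (φ x) x := fun x =>
    intervalIntegral.integral_hasDerivAt_right (hφ.intervalIntegrable _ _)
      hφ.aestronglyMeasurable.stronglyMeasurableAtFilter hφ.continuousAt
  exact (d t).sub (by simpa using (d (t - h)).comp_sub_const t h)

theorem contDiff_integral_window {φ : ℝ → ℝ} (hφ : ContDiff ℝ ∞ φ) (h : ℝ) :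
    ContDiff ℝ ∞ (fun t => ∫ r in (t - h)..t, φ r) := by
  rw [contDiff_infty_iff_deriv]
  refine ⟨fun t => (hasDerivAt_integral_window hφ.continuous h t).differentiableAt, ?_⟩
  rw [funext fun t => (hasDerivAt_integral_window hφ.continuous h t).deriv]
  fun_prop

theorem tsupport_integral_window_subset {φ : ℝ → ℝ} (hc : HasCompactSupport φ) {h : ℝ}
    (hh : 0 ≤ h) :
    tsupport (fun t => ∫ r in (t - h)..t, φ r)
      ⊆ (fun z : ℝ × ℝ => z.1 + z.2) '' (tsupport φ ×ˢ Icc 0 h) := by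
  have hKc : IsCompact ((fun z : ℝ × ℝ => z.1 + z.2) '' (tsupport φ ×ˢ Icc 0 h)) :=
    (hc.prod isCompact_Icc).image (by fun_prop)
  refine closure_minimal (fun t ht => ?_) hKc.isClosed
  by_contra hn
  refine ht (intervalIntegral.integral_zero_ae (.of_forall fun r hr => ?_))
  rw [uIoc_of_le (by linarith)] at hr
  by_contra h0
  exact hn ⟨(r, t - r), ⟨subset_tsupport _ h0, by linarith [hr.2], by linarith [hr.1]⟩, by simp⟩

theorem hasCompactSupport_integral_window {φ : ℝ → ℝ} (hc : HasCompactSupport φ) {h : ℝ}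
    (hh : 0 ≤ h) : HasCompactSupport (fun t => ∫ r in (t - h)..t, φ r) :=
  ((hc.prod isCompact_Icc).image (by fun_prop)).of_isClosed_subset (isClosed_tsupport _)
    (tsupport_integral_window_subset hc hh)

/-- Differences of a function with weak derivative are integrals of the derivative. -/
theorem WeakDerivOn.sub_eq_integral [CompleteSpace H] {I : Set ℝ} (hI : IsOpen I) (hup : IsUpperSet I)
    {U V : ℝ → H} (hU : LocallyIntegrable U) (hV : LocallyIntegrable V)
    (hUV : WeakDerivOn I U V) {h : ℝ} (hh : 0 ≤ h) :
    ∀ᵐ t, t ∈ I → U (t + h) - U t = ∫ r in t..t + h, V r := by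
  have hVi : ∀ a b, IntervalIntegrable V volume a b := fun a b =>
    (hV.integrableOn_isCompact isCompact_uIcc).intervalIntegrable
  have hUh : LocallyIntegrable (fun t => U (t + h)) := by
    rw [locallyIntegrable_iff]
    intro k hk
    have := (measurePreserving_add_right volume h).integrableOn_comp_preimage
      (measurableEmbedding_addRight h) (f := U) (s := (fun t => t + h) '' k)
    rw [preimage_image_eq _ (add_left_injective h)] at this
    exact this.2 (hU.integrableOn_isCompact (hk.image (by fun_prop)))
  have hP : Continuous fun t => ∫ r in t..t + h, V r := by
    have hc := intervalIntegral.continuous_primitive hVi 0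
    have e : (fun t => ∫ r in t..t + h, V r)
        = fun t => (∫ r in (0 : ℝ)..t + h, V r) - ∫ r in (0 : ℝ)..t, V r := by
      ext t
      rw [intervalIntegral.integral_interval_sub_left] <;> exact hVi _ _
    rw [e]
    fun_prop
  have hL : LocallyIntegrable fun t => U (t + h) - U t - ∫ r in t..t + h, V r :=
    (hUh.sub hU).sub hP.locallyIntegrable
  have key := hI.ae_eq_zero_of_integral_contDiff_smul_eq_zero (hL.locallyIntegrableOn I) (μ := volume)
    (fun φ hφ hc hs => ?_)
  · filter_upwards [key] with t ht htI
    exact sub_eq_zero.1 (ht htI)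
  -- The backward window integral ψ of φ is the right test function: ψ' = φ - φ(· - h) produces the
  -- increment of U, and adjointness turns ψ • V into φ times the window integral of V. Its support
  -- lies in supp φ + [0, h], inside I because I is an upper set.
  have hψ := contDiff_integral_window hφ h
  have hψc := hasCompactSupport_integral_window hc hh
  have hψs : tsupport (fun t => ∫ r in (t - h)..t, φ r) ⊆ I := by
    refine (tsupport_integral_window_subset hc hh).trans ?_
    rintro _ ⟨⟨x, y⟩, ⟨hx, hy, -⟩, rfl⟩
    exact hup (le_add_of_nonneg_right hy) (hs hx)
  have h1 := hUV _ hψ hψc hψs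
  rw [← integral_smul_integral_translate hV hφ.continuous hc hh] at h1
  have cs : HasCompactSupport fun t => φ (t - h) := by
    simpa [sub_eq_add_neg, Function.comp_def] using hc.comp_homeomorph (Homeomorph.addRight (-h))
  have i1 : Integrable fun t => φ t • U t :=
    hU.integrable_smul_left_of_hasCompactSupport hφ.continuous hc
  have i2 : Integrable fun t => φ (t - h) • U t :=
    hU.integrable_smul_left_of_hasCompactSupport
      (hφ.continuous.comp (continuous_sub_right h)) cs
  have i3 : Integrable fun t => φ t • U (t + h) :=
    hUh.integrable_smul_left_of_hasCompactSupport hφ.continuous hc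
  have i4 : Integrable fun t => φ t • ∫ r in t..t + h, V r :=
    hP.locallyIntegrable.integrable_smul_left_of_hasCompactSupport hφ.continuous hc
  have e1 : ∫ t, deriv (fun t => ∫ r in (t - h)..t, φ r) t • U t
      = (∫ t, φ t • U t) - ∫ t, φ t • U (t + h) := by
    rw [← integral_add_right_eq_self (fun t => φ t • U (t + h)) (-h)]
    have : (fun t => deriv (fun t => ∫ r in (t - h)..t, φ r) t • U t)
        = fun t => φ t • U t - φ (t - h) • U t := by
      ext t
      rw [(hasDerivAt_integral_window hφ.continuous h t).deriv, sub_smul]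
    simp only [← sub_eq_add_neg]
    rw [this, integral_sub i1 i2]
    simp
  rw [e1] at h1
  have : (fun t => φ t • (U (t + h) - U t - ∫ r in t..t + h, V r))
      = fun t => φ t • U (t + h) - φ t • U t - φ t • ∫ r in t..t + h, V r := by
    ext t
    rw [smul_sub, smul_sub]
  rw [this, integral_sub (f := fun t => φ t • U (t + h) - φ t • U t) (i3.sub i1) i4,
    integral_sub i3 i1, sub_eq_zero, ← neg_sub, h1, neg_neg]

theorem ae_translate {p : ℝ → Prop} (hp : ∀ᵐ t, p t) (h : ℝ) : ∀ᵐ t, p (t + h) :=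
  (measurePreserving_add_right volume h).quasiMeasurePreserving.ae hp

theorem intervalIntegrable_of_locallyIntegrable {E : Type*} [NormedAddCommGroup E] {V : ℝ → E}
    (hV : LocallyIntegrable V) (a b : ℝ) : IntervalIntegrable V volume a b :=
  (hV.integrableOn_isCompact isCompact_uIcc).intervalIntegrable

/-- Subtracting the primitive of V leaves W, which for each h satisfies W(t + h) = W(t) for a.e. t.
Exchanging the quantifiers by Fubini gives one t that works for a.e. h, so W is a.e. constant. -/
theorem WeakDerivOn.exists_continuous_ae_eq [CompleteSpace H] {U V : ℝ → H}
    (hm : StronglyMeasurable U) (hU : LocallyIntegrable U) (hV : LocallyIntegrable V)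
    (hUV : WeakDerivOn univ U V) : ∃ g : ℝ → H, Continuous g ∧ U =ᵐ[volume] g := by
  have hVi := intervalIntegrable_of_locallyIntegrable hV
  have hc := intervalIntegral.continuous_primitive hVi 0
  set Φ : ℝ → H := fun t => ∫ r in (0 : ℝ)..t, V r with hΦ
  set W : ℝ → H := fun t => U t - Φ t with hW
  have hWm : StronglyMeasurable W := hm.sub hc.stronglyMeasurable
  have hpos : ∀ h : ℝ, 0 ≤ h → ∀ᵐ t, W (t + h) = W t := by
    intro h hh
    filter_upwards [hUV.sub_eq_integral isOpen_univ isUpperSet_univ hU hV hh] with t ht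
    have := ht (mem_univ _)
    rw [← intervalIntegral.integral_interval_sub_left (hVi 0 _) (hVi 0 _)] at this
    simp only [hW, hΦ]
    rw [sub_eq_sub_iff_sub_eq_sub, this]
  have hall : ∀ h : ℝ, ∀ᵐ t, W (t + h) = W t := by
    intro h
    rcases le_total 0 h with hh | hh
    · exact hpos h hh
    · filter_upwards [ae_translate (hpos (-h) (by linarith)) h] with t ht
      simpa using ht.symm
  have hmeas : MeasurableSet {x : ℝ × ℝ | W (x.2 + x.1) = W x.2} :=
    (hWm.comp_measurable (by fun_prop)).measurableSet_eq_fun (hWm.comp_measurable (by fun_prop))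
  have hsw := (Measure.ae_ae_comm (μ := volume) (ν := volume)
    (p := fun h t => W (t + h) = W t) hmeas).1 (.of_forall hall)
  obtain ⟨t, ht⟩ := hsw.exists
  refine ⟨fun s => W t + Φ s, by fun_prop, ?_⟩
  have := ae_translate ht (-t)
  filter_upwards [this] with s hs
  rw [← hs]
  simp [hW]

/-- A function on the half-line that vanishes at `0` can be extended by zero. -/
theorem WeakDerivOn.of_zero_boundary [CompleteSpace H] {U V g : ℝ → H}
    (hU : LocallyIntegrable U) (hV : LocallyIntegrable V)
    (hU0 : ∀ t ≤ 0, U t = 0) (hV0 : ∀ t ≤ 0, V t = 0) (hg : ContinuousOn g (Ici 0))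
    (hg0 : g 0 = 0) (hUg : ∀ᵐ t, 0 < t → U t = g t) (hUV : WeakDerivOn (Ioi 0) U V) :
    WeakDerivOn univ U V := by
  have hVi := intervalIntegrable_of_locallyIntegrable hV
  have hc := intervalIntegral.continuous_primitive hVi 0
  have hsub : ∀ s t, ∫ r in s..t, V r = (∫ r in (0 : ℝ)..t, V r) - ∫ r in (0 : ℝ)..s, V r :=
    fun s t => (intervalIntegral.integral_interval_sub_left (hVi 0 _) (hVi 0 _)).symm
  -- The increment formula holds a.e. on (0, ∞); both sides are continuous on [0, ∞), so it may be
  -- evaluated at t = 0, where g vanishes.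
  have hG : ∀ h : ℝ, 0 ≤ h → g h = ∫ r in (0 : ℝ)..h, V r := by
    intro h hh
    have key : EqOn (fun t => g (t + h) - g t) (fun t => ∫ r in t..t + h, V r) (Ici 0) := by
      refine Measure.eqOn_of_ae_eq (μ := volume) ?_ ?_ ?_ ?_
      · rw [Filter.EventuallyEq, ← Measure.restrict_congr_set (Ioi_ae_eq_Ici (a := (0 : ℝ))),
          ae_restrict_iff' measurableSet_Ioi]
        filter_upwards [hUV.sub_eq_integral isOpen_Ioi (isUpperSet_Ioi 0) hU hV hh, hUg,
          ae_translate hUg h] with t h1 h2 h3 ht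
        have ht' : 0 < t := ht
        rw [← h1 ht, h2 ht, h3 (by linarith)]
      · refine (hg.comp (by fun_prop) fun t ht => ?_).sub hg
        exact add_nonneg ht hh
      · rw [funext fun t => hsub t (t + h)]
        exact Continuous.continuousOn (by fun_prop)
      · rw [interior_Ici, closure_Ioi]
    simpa [hg0] using key self_mem_Ici
  have hΦ0 : ∀ t : ℝ, t ≤ 0 → ∫ r in (0 : ℝ)..t, V r = 0 := by
    intro t ht
    refine intervalIntegral.integral_zero_ae (.of_forall fun r hr => hV0 r ?_)
    rw [uIoc_of_ge ht] at hr
    exact hr.2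
  have hUall : ∀ᵐ t, U t = ∫ r in (0 : ℝ)..t, V r := by
    filter_upwards [hUg] with t ht
    rcases le_or_gt t 0 with h0 | h0
    · rw [hU0 t h0, hΦ0 t h0]
    · rw [ht h0, hG t h0.le]
  intro φ hφ hcs _
  obtain ⟨M, hM⟩ := hcs.isCompact.bddAbove
  -- With φ zero beyond h, the adjointness identity for φ'(· + h) is integration by parts. On its
  -- left side only t ≤ 0 contributes, where the window integral of V is U(t + h); on its right only
  -- t > 0, where the window integral of φ'(· + h) is φ(t + h) - φ(t) = -φ(t).
  set h := max M 0 with hh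
  have hφM : ∀ t, h < t → φ t = 0 := fun t ht =>
    image_eq_zero_of_notMem_tsupport fun hn => absurd (hM hn) (by simp [hh] at ht ⊢; exact ht.1)
  have hφM' : ∀ t, h < t → deriv φ t = 0 := fun t ht =>
    image_eq_zero_of_notMem_tsupport fun hn =>
      absurd (hM (tsupport_deriv_subset hn)) (by simp [hh] at ht ⊢; exact ht.1)
  have hcd : Continuous (deriv φ) := hφ.continuous_deriv (by simp)
  have cs : HasCompactSupport fun t => deriv φ (t + h) := by
    simpa [Function.comp_def] using hcs.deriv.comp_homeomorph (Homeomorph.addRight h)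
  have key := integral_smul_integral_translate hV (φ := fun t => deriv φ (t + h)) (by fun_prop) cs
    (h := h) (le_max_right _ _)
  have e1 : ∫ t, deriv φ (t + h) • (∫ r in t..t + h, V r) = ∫ t, deriv φ t • U t := by
    rw [← integral_add_right_eq_self (fun t => deriv φ t • U t) h]
    refine integral_congr_ae ?_
    filter_upwards [ae_translate hUall h] with t ht
    rcases le_or_gt t 0 with h0 | h0
    · rw [hsub, hΦ0 t h0, sub_zero, ht]
    · rw [hφM' _ (by linarith), zero_smul, zero_smul]
  have e2 : ∫ t, (∫ r in (t - h)..t, deriv φ (r + h)) • V t = -∫ t, φ t • V t := by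
    rw [← integral_neg]
    refine integral_congr_ae (.of_forall fun t => ?_)
    simp only
    rcases le_or_gt t 0 with h0 | h0
    · simp [hV0 t h0]
    · rw [intervalIntegral.integral_comp_add_right (fun r => deriv φ r),
        intervalIntegral.integral_deriv_eq_sub
          (fun x _ => (hφ.differentiable (by simp)).differentiableAt)
          (hcd.intervalIntegrable _ _), hφM _ (by linarith)]
      simp
  rw [← e1, key, e2]

theorem sq_lintegral_le {α : Type*} [MeasurableSpace α] (μ : Measure α) {f : α → ℝ≥0∞}
    (hf : AEMeasurable f μ) : (∫⁻ a, f a ∂μ) ^ 2 ≤ μ univ * ∫⁻ a, f a ^ 2 ∂μ := by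
  have h := ENNReal.lintegral_mul_le_Lp_mul_Lq μ Real.HolderConjugate.two_two hf
    (aemeasurable_const (b := (1 : ℝ≥0∞)))
  have h2 := pow_le_pow_left' h 2
  simp only [Pi.mul_apply, mul_one, mul_pow, one_div, ENNReal.rpow_two, one_pow, lintegral_one,
    ← ENNReal.rpow_natCast, ← ENNReal.rpow_mul] at h2
  norm_num at h2
  rwa [mul_comm]

/-- One factor h comes from Cauchy-Schwarz on a window of length h, the other from Tonelli and
translation invariance. -/
theorem WeakDerivOn.lintegral_sub_translate_le [CompleteSpace H] {U V : ℝ → H}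
    (hU : LocallyIntegrable U) (hV : LocallyIntegrable V) (hm : StronglyMeasurable V)
    (hUV : WeakDerivOn univ U V) {h : ℝ} (hh : 0 ≤ h) :
    ∫⁻ t, ‖U (t + h) - U t‖ₑ ^ 2 ≤ ENNReal.ofReal (h ^ 2) * ∫⁻ t, ‖V t‖ₑ ^ 2 := by
  have hmV : Measurable fun t => ‖V t‖ₑ := hm.enorm
  calc ∫⁻ t, ‖U (t + h) - U t‖ₑ ^ 2
      ≤ ∫⁻ t, ENNReal.ofReal h * ∫⁻ r in Ioc 0 h, ‖V (r + t)‖ₑ ^ 2 := by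
        refine lintegral_mono_ae ?_
        filter_upwards [hUV.sub_eq_integral isOpen_univ isUpperSet_univ hU hV hh] with t ht
        have e : ∫ r in t..t + h, V r = ∫ r in Ioc 0 h, V (r + t) := by
          rw [← intervalIntegral.integral_of_le hh,
            intervalIntegral.integral_comp_add_right (fun x => V x), zero_add, add_comm h t]
        rw [ht (mem_univ _), e]
        refine (pow_le_pow_left' (enorm_integral_le_lintegral_enorm _) 2).trans ?_
        refine (sq_lintegral_le _ (hmV.comp (measurable_add_const t)).aemeasurable).trans_eq ?_
        simp
    _ = ENNReal.ofReal h * ∫⁻ r in Ioc 0 h, ∫⁻ t, ‖V (r + t)‖ₑ ^ 2 := by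
        rw [lintegral_const_mul' _ _ (by simp), lintegral_lintegral_swap]
        exact Measurable.aemeasurable (by unfold Function.uncurry; fun_prop)
    _ = _ := by
        simp_rw [lintegral_add_left_eq_self (fun t => ‖V t‖ₑ ^ 2)]
        rw [lintegral_const, pow_two h, ENNReal.ofReal_mul hh]
        simp only [Measure.restrict_apply_univ, Real.volume_Ioc, sub_zero]
        ring

end WeakDerivative

/-! ### Extension by zero and reflection as maps between the L² and H¹ spaces. -/

section SpacesMaps

variable {H : Type*} [NormedAddCommGroup H]

theorem enorm_sq_L2 {I : Set ℝ} (u : L2 I H) : ‖u‖ₑ ^ 2 = ∫⁻ t in I, ‖u t‖ₑ ^ 2 := by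
  have := eLpNorm_nnreal_pow_eq_lintegral (f := u) (p := 2) (μ := volume.restrict I) two_ne_zero
  rw [Lp.enorm_def]
  simpa using this

theorem enorm_sq_L2_univ (u : L2 univ H) : ‖u‖ₑ ^ 2 = ∫⁻ t, ‖u t‖ₑ ^ 2 := by
  rw [enorm_sq_L2]
  exact setLIntegral_univ _

theorem enorm_sq_withLp_prod {A B : Type*} [NormedAddCommGroup A] [NormedAddCommGroup B]
    (x : WithLp 2 (A × B)) : ‖x‖ₑ ^ 2 = ‖x.fst‖ₑ ^ 2 + ‖x.snd‖ₑ ^ 2 := by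
  have h := congrArg ENNReal.ofReal (WithLp.prod_norm_sq_eq_of_L2 x)
  rwa [ENNReal.ofReal_add (by positivity) (by positivity),
    ENNReal.ofReal_pow (norm_nonneg _), ENNReal.ofReal_pow (norm_nonneg _),
    ENNReal.ofReal_pow (norm_nonneg _), ofReal_norm, ofReal_norm, ofReal_norm] at h

theorem ae_restrict_univ_iff {p : ℝ → Prop} :
    (∀ᵐ t ∂volume.restrict univ, p t) ↔ ∀ᵐ t : ℝ, p t := by
  rw [Measure.restrict_univ]

theorem coeFn_memLp_univ (u : L2 univ H) : MemLp u 2 volume := by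
  simpa using Lp.memLp u

theorem coeFn_locallyIntegrable (u : L2 univ H) : LocallyIntegrable u :=
  (coeFn_memLp_univ u).locallyIntegrable (by norm_num)

theorem memLp_indicator_coeFn (w : L2 (Ioi 0) H) :
    MemLp ((Ioi (0 : ℝ)).indicator w) 2 volume := by
  rw [memLp_indicator_iff_restrict measurableSet_Ioi]
  exact Lp.memLp w

theorem zeroExt_ae_eq (w : L2 (Ioi 0) H) : zeroExt w =ᵐ[volume] (Ioi (0 : ℝ)).indicator w := by
  exact ae_restrict_univ_iff.1 (MemLp.coeFn_toLp _)

theorem ext_L2_univ {u v : L2 univ H} (h : u =ᵐ[volume] v) : u = v :=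
  Lp.ext (ae_restrict_univ_iff.2 h)

theorem coeFn_add_univ (u v : L2 univ H) : (u + v : L2 univ H) =ᵐ[volume] u + v := by
  simpa using Lp.coeFn_add u v

theorem coeFn_sub_univ (u v : L2 univ H) : (u - v : L2 univ H) =ᵐ[volume] u - v := by
  simpa using Lp.coeFn_sub u v

theorem ae_of_ae_Ioi {p : ℝ → Prop} (h : ∀ᵐ t ∂volume.restrict (Ioi (0 : ℝ)), p t) :
    ∀ᵐ t, t ∈ Ioi (0 : ℝ) → p t :=
  (ae_restrict_iff' measurableSet_Ioi).1 h

theorem zeroExt_add (u v : L2 (Ioi 0) H) : zeroExt (u + v) = zeroExt u + zeroExt v := by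
  refine ext_L2_univ ?_
  filter_upwards [zeroExt_ae_eq (u + v), zeroExt_ae_eq u, zeroExt_ae_eq v,
    coeFn_add_univ (zeroExt u) (zeroExt v), ae_of_ae_Ioi (Lp.coeFn_add u v)] with t h1 h2 h3 h4 h5
  rw [h1, h4, Pi.add_apply, h2, h3]
  by_cases ht : t ∈ Ioi (0 : ℝ)
  · simp only [indicator_of_mem ht, h5 ht, Pi.add_apply]
  · simp only [indicator_of_notMem ht, add_zero]

theorem enorm_zeroExt (w : L2 (Ioi 0) H) : ‖zeroExt w‖ₑ = ‖w‖ₑ := by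
  rw [Lp.enorm_def, Lp.enorm_def, eLpNorm_congr_ae (ae_restrict_univ_iff.2 (zeroExt_ae_eq w)),
    Measure.restrict_univ, eLpNorm_indicator_eq_eLpNorm_restrict measurableSet_Ioi]

theorem zeroExt_sub (u v : L2 (Ioi 0) H) : zeroExt (u - v) = zeroExt u - zeroExt v := by
  rw [eq_sub_iff_add_eq, ← zeroExt_add, sub_add_cancel]

variable [InnerProductSpace ℝ H]

theorem zeroExt_smul (c : ℝ) (u : L2 (Ioi 0) H) : zeroExt (c • u) = c • zeroExt u := by
  refine ext_L2_univ ?_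
  have hs : (c • zeroExt u : L2 univ H) =ᵐ[volume] c • zeroExt u := by
    simpa using Lp.coeFn_smul c (zeroExt u)
  filter_upwards [zeroExt_ae_eq (c • u), zeroExt_ae_eq u, hs,
    ae_of_ae_Ioi (Lp.coeFn_smul c u)] with t h1 h2 h4 h5
  rw [h1, h4, Pi.smul_apply, h2]
  by_cases ht : t ∈ Ioi (0 : ℝ)
  · simp only [indicator_of_mem ht, h5 ht, Pi.smul_apply]
  · simp only [indicator_of_notMem ht, smul_zero]

theorem hasWeakDeriv_univ_iff {u v : L2 univ H} : HasWeakDeriv univ u v ↔ WeakDerivOn univ u v := by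
  simp only [HasWeakDeriv, WeakDerivOn, Measure.restrict_univ]

theorem WeakDerivOn.congr {I : Set ℝ} {U V U' V' : ℝ → H} (h : WeakDerivOn I U V)
    (hU : U' =ᵐ[volume] U) (hV : V' =ᵐ[volume] V) : WeakDerivOn I U' V' := by
  intro φ hφ hc hs
  rw [integral_congr_ae (g := fun t => deriv φ t • U t) (by filter_upwards [hU] with t ht; rw [ht]),
    integral_congr_ae (f := fun t => φ t • V' t) (g := fun t => φ t • V t)
      (by filter_upwards [hV] with t ht; rw [ht])]
  exact h φ hφ hc hs

theorem HasWeakDeriv.weakDerivOn_indicator {u v : L2 (Ioi 0) H} (h : HasWeakDeriv (Ioi 0) u v) :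
    WeakDerivOn (Ioi 0) ((Ioi (0 : ℝ)).indicator u) ((Ioi (0 : ℝ)).indicator v) := by
  intro φ hφ hc hs
  simp_rw [← indicator_smul]
  rw [integral_indicator measurableSet_Ioi, integral_indicator measurableSet_Ioi]
  exact h φ hφ hc hs

/-- The vanishing trace is what excludes a point mass at 0 in the derivative of the extension. -/
theorem hasWeakDeriv_zeroExt [CompleteSpace H] (p : H10 H) :
    HasWeakDeriv univ (zeroExt p.1.fst) (zeroExt p.1.snd) := by
  obtain ⟨⟨u, v⟩, hp, g, hg, hg0, hpg⟩ := p
  rw [hasWeakDeriv_univ_iff]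
  have hz : ∀ w : L2 (Ioi 0) H, ∀ t ≤ 0, (Ioi (0 : ℝ)).indicator w t = 0 := fun w t ht =>
    indicator_of_notMem (by simpa using ht) _
  refine (WeakDerivOn.of_zero_boundary ((memLp_indicator_coeFn _).locallyIntegrable (by norm_num))
    ((memLp_indicator_coeFn _).locallyIntegrable (by norm_num)) (hz _) (hz _) hg hg0 ?_
    (HasWeakDeriv.weakDerivOn_indicator hp)).congr (zeroExt_ae_eq _) (zeroExt_ae_eq _)
  filter_upwards [ae_of_ae_Ioi hpg] with t ht h0
  exact (indicator_of_mem (s := Ioi (0 : ℝ)) h0 _).trans (ht h0)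

theorem memLp_reflect (c : ℝ) (u : L2 univ H) :
    MemLp (fun t => u t + c • u (-t)) 2 (volume.restrict (Ioi 0)) :=
  ((coeFn_memLp_univ u).add (((coeFn_memLp_univ u).comp_measurePreserving
    (Measure.measurePreserving_neg volume)).const_smul c)).restrict _

/-- The map `u ↦ u(t) + c u(-t)` from functions on the line to functions on the half-line. -/
def reflect (c : ℝ) (u : L2 univ H) : L2 (Ioi 0) H := (memLp_reflect c u).toLp _

theorem reflect_ae_eq (c : ℝ) (u : L2 univ H) :
    reflect c u =ᵐ[volume.restrict (Ioi 0)] fun t => u t + c • u (-t) :=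
  MemLp.coeFn_toLp _

theorem ae_neg {p : ℝ → Prop} (hp : ∀ᵐ t, p t) : ∀ᵐ t, p (-t) :=
  (Measure.measurePreserving_neg (volume : Measure ℝ)).quasiMeasurePreserving.ae hp

theorem reflect_sub (c : ℝ) (u v : L2 univ H) : reflect c (u - v) = reflect c u - reflect c v := by
  refine Lp.ext ?_
  filter_upwards [reflect_ae_eq c (u - v), reflect_ae_eq c u, reflect_ae_eq c v,
    Lp.coeFn_sub (reflect c u) (reflect c v), ae_restrict_of_ae (coeFn_sub_univ u v),
    ae_restrict_of_ae (ae_neg (coeFn_sub_univ u v))] with t h1 h2 h3 h4 h5 h6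
  rw [h1, h4, Pi.sub_apply, h2, h3, h5, h6, Pi.sub_apply, Pi.sub_apply, smul_sub]
  abel

/-- The half-line is enlarged to the line, which costs sharpness; interpolation only needs a finite
constant. -/
theorem enorm_sq_reflect_le {c : ℝ} (hc : ‖c‖ₑ = 1) (u : L2 univ H) :
    ‖reflect c u‖ₑ ^ 2 ≤ 4 * ‖u‖ₑ ^ 2 := by
  have hm : Measurable fun t => ‖u t‖ₑ ^ 2 := (Lp.stronglyMeasurable u).enorm.pow_const 2
  rw [enorm_sq_L2, enorm_sq_L2_univ]
  calc ∫⁻ t in Ioi 0, ‖reflect c u t‖ₑ ^ 2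
      = ∫⁻ t in Ioi 0, ‖u t + c • u (-t)‖ₑ ^ 2 :=
        lintegral_congr_ae (by filter_upwards [reflect_ae_eq c u] with t ht; rw [ht])
    _ ≤ ∫⁻ t, ‖u t + c • u (-t)‖ₑ ^ 2 := setLIntegral_le_lintegral _ _
    _ ≤ ∫⁻ t, 2 * (‖u t‖ₑ ^ 2 + ‖u (-t)‖ₑ ^ 2) := by
        refine lintegral_mono fun t => (enorm_add_sq_le _ _).trans_eq ?_
        rw [enorm_smul, hc, one_mul]
    _ = 2 * ((∫⁻ t, ‖u t‖ₑ ^ 2) + ∫⁻ t, ‖u (-t)‖ₑ ^ 2) := by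
        rw [lintegral_const_mul' _ _ (by simp), lintegral_add_left hm]
    _ = _ := by
        rw [lintegral_neg_eq_self (fun t => ‖u t‖ₑ ^ 2)]
        ring

/-- For t > 0 the reflected value is taken where the extension is zero. -/
theorem reflect_zeroExt (c : ℝ) (w : L2 (Ioi 0) H) : reflect c (zeroExt w) = w := by
  refine Lp.ext ?_
  filter_upwards [reflect_ae_eq c (zeroExt w), ae_restrict_of_ae (zeroExt_ae_eq w),
    ae_restrict_of_ae (ae_neg (zeroExt_ae_eq w)), ae_restrict_mem measurableSet_Ioi] with t h1 h2 h3 h4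
  have : -t ∉ Ioi (0 : ℝ) := by simpa using (le_of_lt h4 : (0 : ℝ) ≤ t)
  rw [h1, h2, h3, indicator_of_mem h4, indicator_of_notMem this, smul_zero, add_zero]

theorem integral_smul_reflect (c : ℝ) (u : L2 univ H) {ψ : ℝ → ℝ} (hψ : Continuous ψ)
    (hc : HasCompactSupport ψ) (hs : tsupport ψ ⊆ Ioi 0) :
    ∫ t in Ioi 0, ψ t • reflect c u t = (∫ t, ψ t • u t) + c • ∫ t, ψ (-t) • u t := by
  have hu := coeFn_locallyIntegrable u
  have hc' : HasCompactSupport fun t => ψ (-t) := by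
    simpa [Function.comp_def] using hc.comp_homeomorph (Homeomorph.neg ℝ)
  have hi := hu.integrable_smul_left_of_hasCompactSupport (g := fun t => ψ (-t)) (by fun_prop) hc'
  have hi' : Integrable fun t => ψ t • u (-t) := by simpa using hi.comp_neg
  have hi2 : Integrable fun t => c • ψ t • u (-t) := hi'.smul c
  calc ∫ t in Ioi 0, ψ t • reflect c u t
      = ∫ t in Ioi 0, (ψ t • u t + c • ψ t • u (-t)) := by
        refine integral_congr_ae ?_
        filter_upwards [reflect_ae_eq c u] with t ht
        rw [ht, smul_add, smul_comm]
    _ = ∫ t, (ψ t • u t + c • ψ t • u (-t)) := by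
        refine setIntegral_eq_integral_of_forall_compl_eq_zero fun t ht => ?_
        rw [image_eq_zero_of_notMem_tsupport fun h => ht (hs h)]
        simp
    _ = _ := by
        rw [integral_add (hu.integrable_smul_left_of_hasCompactSupport hψ hc) hi2,
          integral_smul, ← integral_neg_eq_self (fun t => ψ (-t) • u t)]
        simp

/-- The chain rule flips the sign under reflection, so u(t) - u(-t) has derivative u'(t) + u'(-t);
on test functions this means using φ(t) + φ(-t) on the line. The boundary value vanishes by oddness
of the continuous representative. -/
theorem reflect_mem_H10 [CompleteSpace H] (p : H1 univ H) :
    WithLp.toLp 2 (reflect (-1) p.1.fst, reflect 1 p.1.snd) ∈ H10 H := by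
  obtain ⟨⟨u, v⟩, hp⟩ := p
  have hw : WeakDerivOn univ u v := hasWeakDeriv_univ_iff.1 hp
  have hu := coeFn_locallyIntegrable u
  have hv := coeFn_locallyIntegrable v
  refine ⟨?_, ?_⟩
  · intro φ hφ hc hs
    have hcd : Continuous (deriv φ) := hφ.continuous_deriv (by simp)
    have hd : Differentiable ℝ φ := hφ.differentiable (by simp)
    have hc' : HasCompactSupport fun t => φ (-t) := by
      simpa [Function.comp_def] using hc.comp_homeomorph (Homeomorph.neg ℝ)
    have hcd' : HasCompactSupport fun t => deriv φ (-t) := by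
      simpa [Function.comp_def] using hc.deriv.comp_homeomorph (Homeomorph.neg ℝ)
    have hder : deriv (fun t => φ t + φ (-t)) = fun t => deriv φ t - deriv φ (-t) := by
      ext t
      have h1 : HasDerivAt (fun t => φ (-t)) (deriv φ (-t) * -1) t :=
        (hd (-t)).hasDerivAt.comp t (hasDerivAt_neg t)
      exact ((hd t).hasDerivAt.fun_add h1).deriv.trans (by ring)
    have key := hw (fun t => φ t + φ (-t)) (by fun_prop) (hc.add hc') (subset_univ _)
    simp only [hder, sub_smul, add_smul] at key
    rw [integral_sub (hu.integrable_smul_left_of_hasCompactSupport hcd hc.deriv)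
        (hu.integrable_smul_left_of_hasCompactSupport (by fun_prop) hcd'),
      integral_add (hv.integrable_smul_left_of_hasCompactSupport hφ.continuous hc)
        (hv.integrable_smul_left_of_hasCompactSupport (by fun_prop) hc')] at key
    change ∫ t in Ioi 0, deriv φ t • reflect (-1) u t = -∫ t in Ioi 0, φ t • reflect 1 v t
    rw [integral_smul_reflect _ _ hcd hc.deriv ((tsupport_deriv_subset).trans hs),
      integral_smul_reflect _ _ hφ.continuous hc hs, neg_one_smul, ← sub_eq_add_neg, key, one_smul]
  · obtain ⟨g, hg, hug⟩ := hw.exists_continuous_ae_eq (Lp.stronglyMeasurable u) hu hv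
    refine ⟨fun t => g t - g (-t), by fun_prop, by simp, ?_⟩
    filter_upwards [reflect_ae_eq (-1) u, ae_restrict_of_ae hug,
      ae_restrict_of_ae (ae_neg hug)] with t h1 h2 h3
    rw [h2, h3, neg_one_smul, ← sub_eq_add_neg] at h1
    exact h1

end SpacesMaps

/-! ### Interpolation of bounded maps. -/

section Interpolation

variable {X Y X' Y' : Type*} [NormedAddCommGroup X] [NormedSpace ℝ X]
  [NormedAddCommGroup Y] [NormedSpace ℝ Y] [NormedAddCommGroup X'] [NormedSpace ℝ X']
  [NormedAddCommGroup Y'] [NormedSpace ℝ Y']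

/-- The interpolation property for bounded maps between two pairs of spaces. -/
theorem mem_interpSpace_of_map {ι : X →ₗ[ℝ] Y} {κ : X' →ₗ[ℝ] Y'} (T : Y → Y') (S : X → X')
    {C : ℝ≥0∞} (hC : C ≠ ⊤) (hC0 : C ≠ 0) (hST : ∀ x, κ (S x) = T (ι x))
    (hsub : ∀ u v, T (u - v) = T u - T v) (hT : ∀ u, ‖T u‖ₑ ^ 2 ≤ C * ‖u‖ₑ ^ 2)
    (hS : ∀ x, ‖S x‖ₑ ^ 2 ≤ C * ‖x‖ₑ ^ 2) {s : ℝ} {u : Y} (hu : u ∈ interpSpace ι s) :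
    T u ∈ interpSpace κ s := by
  -- Each competitor x in the infimum for u yields the competitor S x for T u.
  have hK : ∀ t, kFunctionalSq κ t (T u) ≤ C * kFunctionalSq ι t u := by
    intro t
    rw [kFunctionalSq, kFunctionalSq, ENNReal.mul_iInf_of_ne hC0 hC]
    refine le_iInf fun x => (iInf_le _ (S x)).trans ?_
    rw [hST, ← hsub, mul_add, mul_left_comm]
    gcongr
    · exact hT _
    · exact hS x
  have hu' : interpNormSq ι s u < ⊤ := hu
  change interpNormSq κ s (T u) < ⊤
  calc interpNormSq κ s (T u)
      ≤ ∫⁻ t in Ioi (0 : ℝ), C * (ENNReal.ofReal (t ^ (-(2 * s) - 1)) * kFunctionalSq ι t u) := by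
        refine lintegral_mono fun t => ?_
        rw [mul_left_comm]
        gcongr
        exact hK t
    _ = C * interpNormSq ι s u := by rw [lintegral_const_mul' _ _ hC]; rfl
    _ < ⊤ := ENNReal.mul_lt_top hC.lt_top hu'

end Interpolation

/-! ### Transfer between the interpolation spaces, and finiteness of the intrinsic norm. -/

section Spaces

variable {H : Type*} [NormedAddCommGroup H]

theorem measurable_gagliardo (u : L2 univ H) :
    Measurable fun z : ℝ × ℝ => ‖u z.2 - u z.1‖ₑ ^ 2 / ENNReal.ofReal (|z.2 - z.1| ^ 2) :=
  ((((Lp.stronglyMeasurable u).comp_measurable measurable_snd).sub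
    ((Lp.stronglyMeasurable u).comp_measurable measurable_fst)).enorm.pow_const 2).div
    (by fun_prop)

variable [InnerProductSpace ℝ H]

theorem HHalf00_le_HHalf : HHalf00 H ≤ HHalf (Ioi 0) H := fun w hw =>
  mem_interpSpace_of_map (κ := H1.embed (Ioi 0) H) id (fun p : H10 H => ⟨p.1, p.2.1⟩)
    (C := 1) (by simp) (by simp) (fun _ => rfl) (fun _ _ => rfl) (fun u => by simp)
    (fun p => by rw [one_mul]; rfl) hw

variable [CompleteSpace H]

theorem zeroExt_mem_HHalf {w : L2 (Ioi 0) H} (hw : w ∈ HHalf00 H) : zeroExt w ∈ HHalf univ H := by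
  refine mem_interpSpace_of_map (κ := H1.embed univ H) zeroExt
    (fun p : H10 H => ⟨WithLp.toLp 2 (zeroExt p.1.fst, zeroExt p.1.snd), hasWeakDeriv_zeroExt p⟩)
    (C := 1) (by simp) (by simp) (fun _ => rfl) zeroExt_sub
    (fun u => by rw [enorm_zeroExt, one_mul]) (fun p => ?_) hw
  change ‖WithLp.toLp 2 (zeroExt p.1.fst, zeroExt p.1.snd)‖ₑ ^ 2 ≤ 1 * ‖p.1‖ₑ ^ 2
  rw [enorm_sq_withLp_prod, enorm_sq_withLp_prod, one_mul]
  simp [enorm_zeroExt]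

/-- Plain restriction to ℝ_> would not produce the zero boundary value; the odd reflection does, and
it still inverts the extension. -/
theorem mem_HHalf00_of_zeroExt {w : L2 (Ioi 0) H} (hw : zeroExt w ∈ HHalf univ H) :
    w ∈ HHalf00 H := by
  have h1 : ‖(-1 : ℝ)‖ₑ = 1 := by simp
  have h2 : ‖(1 : ℝ)‖ₑ = 1 := by simp
  have := mem_interpSpace_of_map (κ := H10.embed H) (reflect (-1))
    (fun p : H1 univ H => ⟨WithLp.toLp 2 (reflect (-1) p.1.fst, reflect 1 p.1.snd),
      reflect_mem_H10 p⟩)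
    (C := 4) (by simp) (by simp) (fun _ => rfl) (reflect_sub _)
    (enorm_sq_reflect_le h1) (fun p => ?_) hw
  · rwa [reflect_zeroExt] at this
  · change ‖WithLp.toLp 2 (reflect (-1) p.1.fst, reflect 1 p.1.snd)‖ₑ ^ 2 ≤ 4 * ‖p.1‖ₑ ^ 2
    rw [enorm_sq_withLp_prod, enorm_sq_withLp_prod, mul_add]
    exact add_le_add (enorm_sq_reflect_le h1 _) (enorm_sq_reflect_le h2 _)

/-- The `L²` modulus of continuity is controlled by the K-functional of `(L², H¹)`. -/
theorem lintegral_sub_translate_le_kFunctionalSq (u : L2 univ H) {h : ℝ} (hh : 0 ≤ h) :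
    ∫⁻ t, ‖u (t + h) - u t‖ₑ ^ 2 ≤ 8 * kFunctionalSq (H1.embed univ H) h u := by
  rw [kFunctionalSq, ENNReal.mul_iInf_of_ne (by simp) (by simp)]
  refine le_iInf fun p => ?_
  set z : L2 univ H := p.1.fst
  set v : L2 univ H := p.1.snd
  set y : L2 univ H := u - z with hy
  have hzv : WeakDerivOn univ z v := hasWeakDeriv_univ_iff.1 p.2
  have hym : Measurable fun t => ‖y t‖ₑ ^ 2 := (Lp.stronglyMeasurable y).enorm.pow_const 2
  have hyt : ∫⁻ t, ‖y (t + h) - y t‖ₑ ^ 2 ≤ 4 * ‖y‖ₑ ^ 2 := by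
    calc ∫⁻ t, ‖y (t + h) - y t‖ₑ ^ 2
        ≤ ∫⁻ t, 2 * (‖y (t + h)‖ₑ ^ 2 + ‖y t‖ₑ ^ 2) := lintegral_mono fun t => by
          simpa [sub_eq_add_neg] using enorm_add_sq_le (y (t + h)) (-y t)
      _ = 2 * ((∫⁻ t, ‖y (t + h)‖ₑ ^ 2) + ∫⁻ t, ‖y t‖ₑ ^ 2) := by
          rw [lintegral_const_mul' _ _ (by simp), lintegral_add_right _ hym]
      _ = _ := by
          rw [lintegral_add_right_eq_self (fun t => ‖y t‖ₑ ^ 2), enorm_sq_L2_univ]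
          ring
  have hzt := hzv.lintegral_sub_translate_le (coeFn_locallyIntegrable z)
    (coeFn_locallyIntegrable v) (Lp.stronglyMeasurable v) hh
  rw [← enorm_sq_L2_univ] at hzt
  have hym' : Measurable fun t => ‖y (t + h) - y t‖ₑ ^ 2 :=
    ((((Lp.stronglyMeasurable y).comp_measurable (measurable_add_const h)).sub
      (Lp.stronglyMeasurable y)).enorm).pow_const 2
  have hv : ‖v‖ₑ ^ 2 ≤ ‖p‖ₑ ^ 2 := by
    change ‖v‖ₑ ^ 2 ≤ ‖p.1‖ₑ ^ 2
    rw [enorm_sq_withLp_prod]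
    exact le_add_self
  calc ∫⁻ t, ‖u (t + h) - u t‖ₑ ^ 2
      ≤ ∫⁻ t, 2 * (‖y (t + h) - y t‖ₑ ^ 2 + ‖z (t + h) - z t‖ₑ ^ 2) := by
        refine lintegral_mono_ae ?_
        have hs : ∀ᵐ t, u t = y t + z t := by
          filter_upwards [coeFn_sub_univ u z] with t ht
          rw [hy, ht]; simp
        filter_upwards [hs, ae_translate hs h] with t h1 h2
        rw [h1, h2, add_sub_add_comm]
        exact enorm_add_sq_le _ _
    _ = 2 * ((∫⁻ t, ‖y (t + h) - y t‖ₑ ^ 2) + ∫⁻ t, ‖z (t + h) - z t‖ₑ ^ 2) := by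
        rw [lintegral_const_mul' _ _ (by simp), lintegral_add_left hym']
    -- The smooth part z needs only the factor 1; it is enlarged to 4 to match the rough part y and
    -- form a multiple of the K-functional expression.
    _ ≤ 2 * (4 * ‖y‖ₑ ^ 2 + 4 * (ENNReal.ofReal (h ^ 2) * ‖p‖ₑ ^ 2)) := by
        gcongr
        refine hzt.trans ((mul_le_mul_right hv _).trans ?_)
        exact le_mul_of_one_le_left' (by norm_num)
    _ = 8 * (‖y‖ₑ ^ 2 + ENNReal.ofReal (h ^ 2) * ‖p‖ₑ ^ 2) := by ring

/-- Substituting s = t + h turns the double integral into the squared L² modulus of continuity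
integrated against |h|⁻², which the K-functional controls. -/
theorem hHalfNormSq_lt_top {u : L2 univ H} (hu : u ∈ HHalf univ H) : hHalfNormSq u < ⊤ := by
  have hu' : interpNormSq (H1.embed univ H) (1 / 2) u < ⊤ := hu
  set K := fun t => kFunctionalSq (H1.embed univ H) t u
  have hpos : ∀ h : ℝ, 0 ≤ h → ∫⁻ t, ‖u (h + t) - u t‖ₑ ^ 2 ≤ 8 * K h := by
    intro h hh
    simpa only [add_comm h] using lintegral_sub_translate_le_kFunctionalSq u hh
  have habs : ∀ h : ℝ, ∫⁻ t, ‖u (h + t) - u t‖ₑ ^ 2 ≤ 8 * K |h| := by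
    intro h
    rcases le_total 0 h with hh | hh
    · rw [abs_of_nonneg hh]
      exact hpos h hh
    · rw [abs_of_nonpos hh]
      refine le_trans (le_of_eq ?_) (hpos (-h) (by linarith))
      rw [← lintegral_add_left_eq_self (fun t => ‖u (-h + t) - u t‖ₑ ^ 2) h]
      refine lintegral_congr fun t => ?_
      rw [neg_add_cancel_left, enorm_sub_rev]
  have hswap : ∫⁻ t, ∫⁻ s, ‖u s - u t‖ₑ ^ 2 / ENNReal.ofReal (|s - t| ^ 2)
      ≤ ∫⁻ h, 8 * K |h| / ENNReal.ofReal (|h| ^ 2) := by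
    calc ∫⁻ t, ∫⁻ s, ‖u s - u t‖ₑ ^ 2 / ENNReal.ofReal (|s - t| ^ 2)
        = ∫⁻ t, ∫⁻ h, ‖u (h + t) - u t‖ₑ ^ 2 / ENNReal.ofReal (|h| ^ 2) := by
          refine lintegral_congr fun t => ?_
          rw [← lintegral_add_right_eq_self _ t]
          simp
      _ = ∫⁻ h, ∫⁻ t, ‖u (h + t) - u t‖ₑ ^ 2 / ENNReal.ofReal (|h| ^ 2) := by
          refine lintegral_lintegral_swap (Measurable.aemeasurable ?_)
          have := (measurable_gagliardo u).comp
            (f := fun z : ℝ × ℝ => (z.1, z.2 + z.1)) (by fun_prop)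
          simpa [Function.comp_def, Function.uncurry_def] using this
      _ ≤ _ := by
          refine lintegral_mono fun h => ?_
          have hm : Measurable fun t => ‖u (h + t) - u t‖ₑ ^ 2 :=
            ((((Lp.stronglyMeasurable u).comp_measurable (measurable_const_add h)).sub
              (Lp.stronglyMeasurable u)).enorm).pow_const 2
          simp only [div_eq_mul_inv]
          rw [lintegral_mul_const _ hm]
          gcongr
          exact habs h
  -- For s = 1/2 the interpolation weight t^(-2s-1) is t⁻², the same as the Gagliardo weight.
  have hhalf : ∫⁻ h in Ioi (0 : ℝ), 8 * K |h| / ENNReal.ofReal (|h| ^ 2)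
      = 8 * interpNormSq (H1.embed univ H) (1 / 2) u := by
    rw [interpNormSq, ← lintegral_const_mul' _ _ (by simp)]
    refine setLIntegral_congr_fun measurableSet_Ioi fun t ht => ?_
    have ht' : 0 < t := ht
    have e : t ^ (-(2 * (1 / 2 : ℝ)) - 1) = (t ^ 2)⁻¹ := by
      rw [← Real.rpow_natCast, ← Real.rpow_neg ht'.le]
      norm_num
    rw [abs_of_pos ht', mul_div_assoc, div_eq_mul_inv, mul_comm (K t),
      ← ENNReal.ofReal_inv_of_pos (by positivity), e]
  have hneg : ∫⁻ h in Iic (0 : ℝ), 8 * K |h| / ENNReal.ofReal (|h| ^ 2)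
      = ∫⁻ h in Ioi (0 : ℝ), 8 * K |h| / ENNReal.ofReal (|h| ^ 2) := by
    have := (Measure.measurePreserving_neg (volume : Measure ℝ)).setLIntegral_comp_preimage_emb
      (MeasurableEquiv.neg ℝ).measurableEmbedding
      (fun h => 8 * K |h| / ENNReal.ofReal (|h| ^ 2)) (Ici 0)
    rw [setLIntegral_congr (Ioi_ae_eq_Ici (a := (0 : ℝ))), ← this]
    simp
  have hdouble : ∫⁻ t, ∫⁻ s, ‖u s - u t‖ₑ ^ 2 / ENNReal.ofReal (|s - t| ^ 2) < ⊤ := by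
    refine hswap.trans_lt ?_
    rw [← lintegral_add_compl _ (measurableSet_Ioi (a := (0 : ℝ))), compl_Ioi, hneg, hhalf]
    have := ENNReal.mul_lt_top (a := 8) (by simp) hu'
    exact ENNReal.add_lt_top.2 ⟨this, this⟩
  rw [hHalfNormSq]
  simp only [Measure.restrict_univ]
  exact ENNReal.add_lt_top.2 ⟨by simp [lt_top_iff_ne_top], hdouble⟩

end Spaces

/-! ### The exact formula for the intrinsic norm of a zero extension. -/

section ZeroExtension

/-- The integral is that of x⁻² over (t, ∞) after x = t - s. This is the origin of the weight 1/s.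
-/
theorem lintegral_Iic_inv_sq {t : ℝ} (ht : 0 < t) :
    ∫⁻ s in Iic (0 : ℝ), (ENNReal.ofReal (|s - t| ^ 2))⁻¹ = (ENNReal.ofReal t)⁻¹ := by
  have h1 := integral_Ioi_rpow_of_lt (a := -2) (by norm_num) ht
  have h2 := integrableOn_Ioi_rpow_of_lt (a := -2) (by norm_num) ht
  have h3 := ofReal_integral_eq_lintegral_ofReal h2
    ((ae_restrict_iff' measurableSet_Ioi).2 (.of_forall fun x hx =>
      Real.rpow_nonneg (ht.le.trans (le_of_lt hx)) _))
  have e : -t ^ (-2 + 1 : ℝ) / (-2 + 1) = t⁻¹ := by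
    norm_num [Real.rpow_neg_one]
  rw [h1, e, ENNReal.ofReal_inv_of_pos ht] at h3
  rw [h3]
  have := (Measure.measurePreserving_sub_left (volume : Measure ℝ) t).setLIntegral_comp_preimage_emb
      (MeasurableEquiv.subLeft t).measurableEmbedding
      (fun x => (ENNReal.ofReal (x ^ 2))⁻¹) (Ici t)
  have hp : (fun s => t - s) ⁻¹' Ici t = Iic 0 := by ext s; simp
  rw [hp] at this
  calc _ = ∫⁻ s in Iic (0 : ℝ), (ENNReal.ofReal ((t - s) ^ 2))⁻¹ := by
        refine lintegral_congr fun s => ?_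
        rw [sq_abs, ← neg_sub, neg_sq]
    _ = ∫⁻ x in Ioi t, (ENNReal.ofReal (x ^ 2))⁻¹ := by
        rw [this, setLIntegral_congr Ioi_ae_eq_Ici]
    _ = _ := by
        refine setLIntegral_congr_fun measurableSet_Ioi fun x hx => ?_
        have hx' : 0 < x := ht.trans hx
        rw [← ENNReal.ofReal_inv_of_pos (by positivity), Real.rpow_neg hx'.le]
        norm_num

variable {H : Type*} [NormedAddCommGroup H]

/-- Split the plane into quadrants: the positive one gives the seminorm of w, the negative one gives
0, and in each mixed one the kernel integrates out to the weight 1/s. -/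
theorem hHalfNormSq_zeroExt (w : L2 (Ioi 0) H) :
    hHalfNormSq (zeroExt w) =
      hHalfNormSq w + 2 * ∫⁻ s in Ioi (0 : ℝ), ‖w s‖ₑ ^ 2 / ENNReal.ofReal s := by
  set W : ℝ → H := (Ioi (0 : ℝ)).indicator w with hW
  have hWm : StronglyMeasurable W := (Lp.stronglyMeasurable w).indicator measurableSet_Ioi
  have hpos : ∀ t, t ∈ Ioi (0 : ℝ) → W t = w t := fun t ht => indicator_of_mem ht _
  have hneg : ∀ t, t ∈ Iic (0 : ℝ) → W t = 0 := fun t ht => indicator_of_notMem (by simpa using ht) _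
  have hwm : Measurable fun t => ‖w t‖ₑ ^ 2 := (Lp.stronglyMeasurable w).enorm.pow_const 2
  set F : ℝ → ℝ → ℝ≥0∞ := fun t s => ‖W s - W t‖ₑ ^ 2 / ENNReal.ofReal (|s - t| ^ 2) with hF
  have hFm : Measurable fun z : ℝ × ℝ => F z.1 z.2 :=
    (((hWm.comp_measurable measurable_snd).sub
      (hWm.comp_measurable measurable_fst)).enorm.pow_const 2).div (by fun_prop)
  have h0 : ∫⁻ t in univ, ∫⁻ s in univ, ‖zeroExt w s - zeroExt w t‖ₑ ^ 2 /
      ENNReal.ofReal (|s - t| ^ 2) = ∫⁻ t, ∫⁻ s, F t s := by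
    simp only [Measure.restrict_univ]
    refine lintegral_congr_ae ?_
    filter_upwards [zeroExt_ae_eq w] with t ht
    refine lintegral_congr_ae ?_
    filter_upwards [zeroExt_ae_eq w] with s hs
    rw [ht, hs]
  have hker : ∀ t ∈ Ioi (0 : ℝ), ∫⁻ s in Iic (0 : ℝ), ‖w t‖ₑ ^ 2 / ENNReal.ofReal (|s - t| ^ 2)
      = ‖w t‖ₑ ^ 2 / ENNReal.ofReal t := by
    intro t ht
    simp only [div_eq_mul_inv]
    rw [lintegral_const_mul _ (by fun_prop), lintegral_Iic_inv_sq ht]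
  have hright : ∫⁻ t in Ioi (0 : ℝ), ∫⁻ s, F t s
      = (∫⁻ t in Ioi (0 : ℝ), ∫⁻ s in Ioi (0 : ℝ), ‖w s - w t‖ₑ ^ 2 / ENNReal.ofReal (|s - t| ^ 2))
        + ∫⁻ s in Ioi (0 : ℝ), ‖w s‖ₑ ^ 2 / ENNReal.ofReal s := by
    have hm : Measurable fun s => ‖w s‖ₑ ^ 2 / ENNReal.ofReal s := hwm.div (by fun_prop)
    rw [← lintegral_add_right _ hm]
    refine setLIntegral_congr_fun measurableSet_Ioi fun t ht => ?_
    rw [← lintegral_add_compl _ (measurableSet_Ioi (a := (0 : ℝ))), compl_Ioi, ← hker t ht]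
    congr 1
    · refine setLIntegral_congr_fun measurableSet_Ioi fun s hs => ?_
      simp only [hF, hpos t ht, hpos s hs]
    · refine setLIntegral_congr_fun measurableSet_Iic fun s hs => ?_
      simp only [hF, hpos t ht, hneg s hs, zero_sub, enorm_neg]
  have hleft : ∫⁻ t in Iic (0 : ℝ), ∫⁻ s, F t s
      = ∫⁻ s in Ioi (0 : ℝ), ‖w s‖ₑ ^ 2 / ENNReal.ofReal s := by
    rw [lintegral_lintegral_swap hFm.aemeasurable, ← lintegral_add_compl _
      (measurableSet_Ioi (a := (0 : ℝ))), compl_Ioi]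
    have hz : ∫⁻ s in Iic (0 : ℝ), ∫⁻ t in Iic (0 : ℝ), F t s = 0 := by
      rw [setLIntegral_congr_fun (g := fun _ => 0) measurableSet_Iic, lintegral_zero]
      intro s hs
      simp only
      rw [setLIntegral_congr_fun (g := fun _ => 0) measurableSet_Iic, lintegral_zero]
      intro t ht
      simp [hF, hneg t ht, hneg s hs]
    rw [hz, add_zero]
    refine setLIntegral_congr_fun measurableSet_Ioi fun s hs => ?_
    rw [← hker s hs]
    refine setLIntegral_congr_fun measurableSet_Iic fun t ht => ?_
    simp only [hF, hneg t ht, hpos s hs, sub_zero, abs_sub_comm s t]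
  rw [hHalfNormSq, hHalfNormSq, enorm_zeroExt, h0, ← lintegral_add_compl _
    (measurableSet_Ioi (a := (0 : ℝ))), compl_Ioi, hright, hleft]
  ring

end ZeroExtension

/-! ### The intrinsic norm as the pullback of a Hilbert norm. -/

section Norm

variable {H : Type*} [NormedAddCommGroup H]

/-- The weighted difference quotient whose `L²` norm is the Gagliardo seminorm. -/
def diffQuot [NormedSpace ℝ H] (u : L2 univ H) (z : ℝ × ℝ) : H := |z.2 - z.1|⁻¹ • (u z.2 - u z.1)

variable [InnerProductSpace ℝ H]

theorem enorm_diffQuot_sq (u : L2 univ H) (z : ℝ × ℝ) :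
    ‖diffQuot u z‖ₑ ^ 2 = ‖u z.2 - u z.1‖ₑ ^ 2 / ENNReal.ofReal (|z.2 - z.1| ^ 2) := by
  rw [diffQuot, enorm_smul, mul_pow, div_eq_mul_inv, mul_comm]
  -- On the diagonal both sides are 0, since the numerators vanish and 0 / 0 = 0 in `ℝ≥0∞`.
  by_cases h : z.2 = z.1
  · simp [h]
  · have : 0 < |z.2 - z.1| := abs_pos.2 (sub_ne_zero.2 h)
    rw [Real.enorm_eq_ofReal (by positivity), ← ENNReal.ofReal_pow (by positivity), inv_pow,
      ENNReal.ofReal_inv_of_pos (by positivity)]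

theorem stronglyMeasurable_diffQuot (u : L2 univ H) : StronglyMeasurable (diffQuot u) :=
  (Measurable.stronglyMeasurable (by fun_prop)).smul
    (((Lp.stronglyMeasurable u).comp_measurable measurable_snd).sub
      ((Lp.stronglyMeasurable u).comp_measurable measurable_fst))

theorem eLpNorm_diffQuot_sq (u : L2 univ H) :
    eLpNorm (diffQuot u) 2 (volume.prod volume) ^ 2
      = ∫⁻ t in univ, ∫⁻ s in univ, ‖u s - u t‖ₑ ^ 2 / ENNReal.ofReal (|s - t| ^ 2) := by
  have := eLpNorm_nnreal_pow_eq_lintegral (f := diffQuot u) (p := 2)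
    (μ := (volume : Measure ℝ).prod volume) two_ne_zero
  simp only [NNReal.coe_ofNat, ENNReal.coe_ofNat, ENNReal.rpow_ofNat, enorm_diffQuot_sq] at this
  rw [this, lintegral_prod _ (measurable_gagliardo u).aemeasurable]
  simp only [Measure.restrict_univ]

variable [CompleteSpace H]

theorem memLp_diffQuot (u : HHalf univ H) :
    MemLp (diffQuot u.1) 2 ((volume : Measure ℝ).prod volume) := by
  refine ⟨(stronglyMeasurable_diffQuot _).aestronglyMeasurable, ?_⟩
  have h := hHalfNormSq_lt_top u.2
  rw [hHalfNormSq, ← eLpNorm_diffQuot_sq] at h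
  simpa using (ENNReal.add_lt_top.1 h).2

theorem ae_prod_of_ae {p : ℝ → Prop} (hp : ∀ᵐ t : ℝ, p t) :
    ∀ᵐ z : ℝ × ℝ ∂(volume : Measure ℝ).prod volume, p z.1 ∧ p z.2 :=
  (Measure.quasiMeasurePreserving_fst.ae hp).and (Measure.quasiMeasurePreserving_snd.ae hp)

variable (H) in
/-- The map `u ↦ (u, (u(s) - u(t)) / |s - t|)`, which is isometric for the intrinsic norm. -/
def gagliardoMap :
    HHalf univ H →ₗ[ℝ] WithLp 2 (L2 univ H × Lp H 2 ((volume : Measure ℝ).prod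
      (volume : Measure ℝ))) where
  toFun u := WithLp.toLp 2 (u.1, (memLp_diffQuot u).toLp _)
  map_add' u v := by
    rw [← WithLp.toLp_add, Prod.mk_add_mk, ← MemLp.toLp_add]
    congr 2
    refine (MemLp.toLp_eq_toLp_iff _ _).2 ?_
    filter_upwards [ae_prod_of_ae (coeFn_add_univ u.1 v.1)] with z hz
    simp only [diffQuot, Submodule.coe_add, Pi.add_apply, hz.1, hz.2, ← smul_add]
    congr 1
    abel
  map_smul' c u := by
    rw [RingHom.id_apply, ← WithLp.toLp_smul, Prod.smul_mk, ← MemLp.toLp_const_smul]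
    congr 2
    refine (MemLp.toLp_eq_toLp_iff _ _).2 ?_
    have hs : (c • u.1 : L2 univ H) =ᵐ[volume] c • u.1 := by
      simpa using Lp.coeFn_smul c u.1
    filter_upwards [ae_prod_of_ae hs] with z hz
    simp only [diffQuot, Submodule.coe_smul, Pi.smul_apply, hz.1, hz.2]
    rw [← smul_sub, smul_comm]

/-- Since the intrinsic expression is a norm pulled back along a linear map, its homogeneity and
triangle inequality are automatic. -/
theorem enorm_gagliardoMap_sq (u : HHalf univ H) : ‖gagliardoMap H u‖ₑ ^ 2 = hHalfNormSq u.1 := by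
  rw [enorm_sq_withLp_prod, hHalfNormSq, ← eLpNorm_diffQuot_sq]
  change ‖u.1‖ₑ ^ 2 + ‖(memLp_diffQuot u).toLp _‖ₑ ^ 2 = _
  rw [Lp.enorm_toLp]

variable (H) in
/-- Extension by zero as a linear map `H^{1/2}_{00,{0}}(ℝ_>; H) → H^{1/2}(ℝ; H)`. -/
def zeroExtₗ : HHalf00 H →ₗ[ℝ] HHalf univ H where
  toFun w := ⟨zeroExt w.1, zeroExt_mem_HHalf w.2⟩
  map_add' u v := Subtype.ext (zeroExt_add u.1 v.1)
  map_smul' c u := Subtype.ext (zeroExt_smul c u.1)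

end Norm

end ZeroExt

end

theorem mainTheorem6 (H : Type*) [NormedAddCommGroup H] [InnerProductSpace ℝ H]
    [CompleteSpace H] [TopologicalSpace.SeparableSpace H] :
    (ZeroExt.HHalf00 H : Set (ZeroExt.L2 (Set.Ioi 0) H)) =
        {w | w ∈ ZeroExt.HHalf (Set.Ioi 0) H ∧
          ZeroExt.zeroExt w ∈ ZeroExt.HHalf Set.univ H} ∧
    (∃ p : Seminorm ℝ (ZeroExt.HHalf00 H),
      (∀ w, p w = 0 → w = 0) ∧
      ∀ w : ZeroExt.HHalf00 H,
        ENNReal.ofReal (p w ^ 2) =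
          ZeroExt.hHalfNormSq (ZeroExt.zeroExt (w : ZeroExt.L2 (Set.Ioi 0) H))) ∧
    ∀ w ∈ ZeroExt.HHalf00 H,
      ZeroExt.hHalf00NormSq w < ⊤ ∧
      ZeroExt.hHalf00NormSq w ≤ ZeroExt.hHalfNormSq (ZeroExt.zeroExt w) ∧
      ZeroExt.hHalfNormSq (ZeroExt.zeroExt w) ≤ 2 * ZeroExt.hHalf00NormSq w := by

  have hfin : ∀ w ∈ ZeroExt.HHalf00 H, ZeroExt.hHalfNormSq (ZeroExt.zeroExt w) < ⊤ :=
    fun w hw => ZeroExt.hHalfNormSq_lt_top (ZeroExt.zeroExt_mem_HHalf hw)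
  have hle : ∀ w : ZeroExt.L2 (Set.Ioi 0) H,
      ZeroExt.hHalf00NormSq w ≤ ZeroExt.hHalfNormSq (ZeroExt.zeroExt w) := by
    intro w
    rw [ZeroExt.hHalfNormSq_zeroExt, ZeroExt.hHalf00NormSq, two_mul]
    gcongr
    exact le_self_add
  refine ⟨?_, ⟨(normSeminorm ℝ _).comp ((ZeroExt.gagliardoMap H).comp (ZeroExt.zeroExtₗ H)),
    ?_, ?_⟩, fun w hw => ⟨(hle w).trans_lt (hfin w hw), hle w, ?_⟩⟩
  · ext w
    exact ⟨fun hw => ⟨ZeroExt.HHalf00_le_HHalf hw, ZeroExt.zeroExt_mem_HHalf hw⟩,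
      fun hw => ZeroExt.mem_HHalf00_of_zeroExt hw.2⟩
  · intro w hw
    -- Definiteness already follows from the L² component, on which extension by zero is isometric.
    have h0 : ZeroExt.gagliardoMap H (ZeroExt.zeroExtₗ H w) = 0 := norm_eq_zero.1 hw
    have h1 : ZeroExt.zeroExt (w : ZeroExt.L2 (Set.Ioi 0) H) = 0 :=
      congrArg (fun x => WithLp.fst x) h0
    rw [← enorm_eq_zero, ZeroExt.enorm_zeroExt, enorm_eq_zero] at h1
    exact Subtype.ext h1
  · intro w
    change ENNReal.ofReal (‖ZeroExt.gagliardoMap H (ZeroExt.zeroExtₗ H w)‖ ^ 2) = _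
    rw [ENNReal.ofReal_pow (norm_nonneg _), ofReal_norm, ZeroExt.enorm_gagliardoMap_sq]
    rfl
  · rw [ZeroExt.hHalfNormSq_zeroExt, ZeroExt.hHalf00NormSq, mul_add]
    gcongr
    rw [two_mul]
    exact le_self_add
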